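/- Let $\mathbb{D}$ be the open unit disc in $\mathbb{C}$, let $H^2=H^2(\mathbb{D})$ be the Hardy space of functions $f(z)=\sum_{n\ge 0} a_n z^n$ on $\mathbb{D}$ with $\|f\|^2=\sum_{n\ge 0}|a_n|^2<\infty$ (with the corresponding inner product), and let $H^\infty$ be the space of bounded holomorphic functions on $\mathbb{D}$. A sequence $(x_n)_{n\ge 0}$ in a complex Hilbert space $H$ is a frame if there are constants $C_1,C_2>0$ such that $C_1\|x\|^2\le\sum_{n=0}^\infty|\langle x,x_n\rangle|^2\le C_2\|x\|^2$ for all $x\in H$. Let $u\in H^2$ and $\varphi\in H^\infty$. Then $\varphi^n u\in H^2$ for all $n\ge 0$, and the following are equivalent: 1. the sequence $(\varphi^n u)_{n\ge 0}$ is a frame in $H^2$; 2. $\varphi(\mathbb{D})\subseteq\mathbb{D}$, and the weighted composition operator $M_uC_\varphi: f\mapsto u\cdot(f\circ\varphi)$ is a well-defined bounded operator on $H^2$ with a bounded inverse; 3. $\varphi$ is an automorphism of $\mathbb{D}$ (a holomorphic bijection of $\mathbb{D}$ onto itself with holomorphic inverse) and $u$ is bounded and bounded away from zero on $\mathbb{D}$.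 -/

import Mathlib

open scoped Complex.UnitDisc

noncomputable section

namespace Hardy

/-- The sequence space `ℓ²(ℕ)` of square-summable complex sequences. -/
abbrev EllTwo : Type := lp (fun _ : ℕ => ℂ) 2

/-- A power series with square-summable coefficients converges absolutely in the open disc. -/
theorem summable_powerSeries (a : EllTwo) (z : 𝔻) :
    Summable fun n : ℕ => a n * (z : ℂ) ^ n := by
  refine Summable.of_norm_bounded (g := fun n : ℕ => ‖a‖ * ‖(z : ℂ)‖ ^ n)
    ((summable_geometric_of_lt_one (norm_nonneg _) z.norm_lt_one).mul_left _) fun n => ?_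
  rw [norm_mul, norm_pow]
  exact mul_le_mul_of_nonneg_right (lp.norm_apply_le_norm (by norm_num) a n) (by positivity)

/-- The linear map taking a sequence `(aₙ)` in `ℓ²` to the function `z ↦ ∑ aₙ zⁿ` on the disc. -/
def powerSeries : EllTwo →ₗ[ℂ] (𝔻 → ℂ) where
  toFun a z := ∑' n : ℕ, a n * (z : ℂ) ^ n
  map_add' a b := by
    funext z
    have h := (summable_powerSeries a z).tsum_add (summable_powerSeries b z)
    simp only [Pi.add_apply, ← h, lp.coeFn_add, add_mul]
  map_smul' c a := by
    funext z
    simp only [Pi.smul_apply, lp.coeFn_smul, smul_eq_mul, RingHom.id_apply, mul_assoc,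
      tsum_mul_left]

/-- The coefficients of a power series are determined by its sum. -/
theorem powerSeries_injective : Function.Injective powerSeries := by
  rw [← LinearMap.ker_eq_bot, LinearMap.ker_eq_bot']
  intro a ha
  have key : HasFPowerSeriesOnBall (fun _ : ℂ => (0 : ℂ))
      (FormalMultilinearSeries.ofScalars ℂ (fun n => a n)) 0 1 := by
    refine ⟨?_, one_pos, ?_⟩
    · refine ENNReal.le_of_forall_nnreal_lt fun r hr => ?_
      have hr1 : (r : ℝ) < 1 := by exact_mod_cast hr
      refine FormalMultilinearSeries.le_radius_of_bound _ ‖a‖ fun n => ?_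
      rw [FormalMultilinearSeries.ofScalars_norm]
      calc ‖a n‖ * (r : ℝ) ^ n ≤ ‖a n‖ :=
            mul_le_of_le_one_right (norm_nonneg _) (pow_le_one₀ r.2 hr1.le)
        _ ≤ ‖a‖ := lp.norm_apply_le_norm (by norm_num) a n
    · intro y hy
      have hy' : ‖y‖ < 1 := by
        have := hy
        rw [← ENNReal.coe_one, Metric.eball_coe] at this
        simpa using this
      have h0 := congrFun ha (Complex.UnitDisc.mk y hy')
      have hs := (summable_powerSeries a (Complex.UnitDisc.mk y hy')).hasSum
      change (∑' n : ℕ, a n * ((Complex.UnitDisc.mk y hy' : 𝔻) : ℂ) ^ n) = 0 at h0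
      rw [h0] at hs
      simpa [FormalMultilinearSeries.ofScalars_apply_eq, smul_eq_mul, mul_comm] using hs
  have hz := key.hasFPowerSeriesAt.eq_zero
  rw [FormalMultilinearSeries.ofScalars_series_eq_zero] at hz
  ext n
  exact congrFun hz n

/-- The Hardy space `H²(𝔻)`: the functions on the open unit disc of the form `∑ aₙ zⁿ` with
`∑ |aₙ|² < ∞`. -/
def HTwo : Type := LinearMap.range powerSeries

namespace HTwo

instance : AddCommGroup HTwo := inferInstanceAs (AddCommGroup (LinearMap.range powerSeries))

instance : Module ℂ HTwo := inferInstanceAs (Module ℂ (LinearMap.range powerSeries))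

/-- An element of `H²(𝔻)` is a function on the disc. -/
instance : CoeFun HTwo (fun _ => 𝔻 → ℂ) := ⟨fun f => f.1⟩

/-- The sequence of Taylor coefficients of a function in `H²(𝔻)`. -/
def coeffs : HTwo ≃ₗ[ℂ] EllTwo :=
  (LinearEquiv.ofInjective powerSeries powerSeries_injective).symm

/-- The norm `‖f‖² = ∑ |aₙ|²` on `H²(𝔻)`. -/
instance : NormedAddCommGroup HTwo :=
  NormedAddCommGroup.induced HTwo EllTwo coeffs.toLinearMap coeffs.injective

/-- The inner product on `H²(𝔻)`: that of the Taylor coefficients in `ℓ²`. -/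
instance : InnerProductSpace ℂ HTwo where
  norm_smul_le c f := by
    change ‖coeffs (c • f)‖ ≤ ‖c‖ * ‖coeffs f‖
    rw [map_smul, norm_smul]
  inner f g := inner ℂ (coeffs f) (coeffs g)
  norm_sq_eq_re_inner f := norm_sq_eq_re_inner (𝕜 := ℂ) (coeffs f)
  conj_inner_symm f g := inner_conj_symm (coeffs f) (coeffs g)
  add_left f g h := by rw [map_add, inner_add_left]
  smul_left f g c := by rw [map_smul, inner_smul_left]

end HTwo

/-- A function on the open unit disc is holomorphic. -/
def Holomorphic (f : 𝔻 → ℂ) : Prop :=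
  ∃ F : ℂ → ℂ, DifferentiableOn ℂ F (Metric.ball 0 1) ∧ ∀ z : 𝔻, f z = F z

/-- Membership in `H^∞`: bounded holomorphic functions on the open unit disc. -/
def MemHInfty (f : 𝔻 → ℂ) : Prop :=
  Holomorphic f ∧ ∃ C : ℝ, ∀ z, ‖f z‖ ≤ C

/-- `φ` is an automorphism of the disc: a holomorphic bijection of the disc onto itself with
holomorphic inverse. -/
def IsDiscAutomorphism (φ : 𝔻 → ℂ) : Prop :=
  ∃ e : 𝔻 ≃ 𝔻, (∀ z, φ z = e z) ∧
    Holomorphic (fun z => (e z : ℂ)) ∧ Holomorphic (fun z => (e.symm z : ℂ))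

/-- The sequence `(xₙ)` is a frame: `C₁ ‖x‖² ≤ ∑ |⟨x, xₙ⟩|² ≤ C₂ ‖x‖²` for all `x`, with
constants `C₁, C₂ > 0`. -/
def IsFrame {H : Type*} [NormedAddCommGroup H] [InnerProductSpace ℂ H] (x : ℕ → H) : Prop :=
  ∃ C₁ C₂ : ℝ, 0 < C₁ ∧ 0 < C₂ ∧ ∀ y : H,
    Summable (fun n => ‖inner ℂ y (x n)‖ ^ 2) ∧
    C₁ * ‖y‖ ^ 2 ≤ ∑' n, ‖inner ℂ y (x n)‖ ^ 2 ∧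
    ∑' n, ‖inner ℂ y (x n)‖ ^ 2 ≤ C₂ * ‖y‖ ^ 2

/-- The weighted composition operator `M_u C_φ : f ↦ u · (f ∘ φ)` is well defined (so `φ` maps the
disc into itself and `u · (f ∘ φ)` is in `H²` for all `f` in `H²`), bounded, and invertible in the
algebra of bounded operators on `H²(𝔻)`. -/
def WeightedCompositionInvertible (u φ : 𝔻 → ℂ) : Prop :=
  ∃ σ : 𝔻 → 𝔻, (∀ z, (σ z : ℂ) = φ z) ∧
    ∃ W : HTwo →L[ℂ] HTwo, (∀ (f : HTwo) (z : 𝔻), W f z = u z * f (σ z)) ∧ IsUnit W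

/-- `u` is bounded and bounded away from zero on the disc. -/
def BoundedAboveAndBelow (u : 𝔻 → ℂ) : Prop :=
  (∃ C : ℝ, ∀ z, ‖u z‖ ≤ C) ∧ ∃ c : ℝ, 0 < c ∧ ∀ z, c ≤ ‖u z‖

end Hardy

end

/-!
Write `W f = u · (f ∘ φ)` and let `k_w(z) = 1 / (1 - w̄ z)` be the reproducing kernel of `H²`, so
that `⟨k_w, f⟩ = f w`. Everything rests on `W zⁿ = φⁿ u`.

*Frames and invertibility.* If `W` is invertible then `∑ |⟨y, φⁿ u⟩|² = ‖W* y‖²`, which is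
comparable to `‖y‖²` (`isFrame_map_monomial`). Conversely, the frame inequalities for `y = k_z`
say that `|u z|² ∑ |φ z|²ⁿ` is finite and positive, whence `u z ≠ 0` and `|φ z| < 1`; the
synthesis operator of the frame (`IsFrame.exists_synthesis`) is bounded and onto, and it is `W`.
Since `1` and `z` are in the range of `W`, the map `φ` is injective (`injective_of_surjective`),
so by the identity theorem `W` is injective too.

*Invertibility implies that `φ` is an automorphism* (`exists_holomorphic_inverse`). The functions
`gₙ = W⁻¹ zⁿ` satisfy `gᵢ gⱼ = gₖ gₗ` for `i + j = k + l`, first on the range of `φ` and then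
everywhere. Thus `g₀(w) = 0` would make all `gₙ(w)` vanish, although the functional
`f ↦ (W⁻¹ f)(w)` is not zero. Hence `gₙ = g₀ ψⁿ` with `ψ = g₁ / g₀`, and boundedness of the
functional makes `(gₙ(w))ₙ` square-summable, so that `|ψ(w)| < 1`. This `ψ` inverts `φ`.

*Automorphisms compose boundedly* (`exists_compOperator`). An automorphism `e` with `e(a) = 0` is
a unimodular multiple of a Blaschke factor, by the Schwarz lemma, and multiplication by it is
isometric on `H²`. Therefore `⟨k_a, eⁿ k_a⟩ = e(a)ⁿ k_a(a) = 0` for `n > 0`, the functions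
`eⁿ k_a` are orthogonal of equal norm, and `f ↦ k_a · (f ∘ e)` is a multiple of an isometry. This
reduces the last equivalence to multiplication operators: multiplication by a bounded holomorphic
function is bounded on `H²` (`HTwo.exists_mul`, by Parseval's identity on circles), and a function
that multiplies `H²` boundedly into itself is bounded (`norm_le_of_mulOperator`).
-/

noncomputable section

namespace Hardy

open Filter Topology ComplexConjugate

/-! ### Point evaluations, kernels and monomials in the Hardy space -/

namespace HTwo

theorem ext_apply {f g : HTwo} (h : ∀ z, f z = g z) : f = g :=
  Subtype.ext (funext h)

theorem apply_eq_tsum (f : HTwo) (z : 𝔻) : f z = ∑' n, coeffs f n * (z : ℂ) ^ n :=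
  (congrFun (congrArg Subtype.val
    ((LinearEquiv.ofInjective powerSeries powerSeries_injective).apply_symm_apply f)) z).symm

theorem hasSum_apply (f : HTwo) (z : 𝔻) : HasSum (fun n => coeffs f n * (z : ℂ) ^ n) (f z) := by
  rw [apply_eq_tsum]
  exact (summable_powerSeries (coeffs f) z).hasSum

theorem add_apply (f g : HTwo) (z : 𝔻) : (f + g) z = f z + g z := rfl

theorem sub_apply (f g : HTwo) (z : 𝔻) : (f - g) z = f z - g z := rfl

theorem smul_apply (c : ℂ) (f : HTwo) (z : 𝔻) : (c • f) z = c * f z := rfl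

theorem zero_apply (z : 𝔻) : (0 : HTwo) z = 0 := rfl

/-- Taylor coefficients identify `H²` isometrically with `ℓ²`. -/
def coeffsIso : HTwo ≃ₗᵢ[ℂ] EllTwo := ⟨coeffs, fun _ => rfl⟩

theorem norm_coeffs (f : HTwo) : ‖coeffs f‖ = ‖f‖ := rfl

instance : CompleteSpace HTwo :=
  coeffsIso.toIsometryEquiv.completeSpace

theorem inner_def (f g : HTwo) : inner ℂ f g = inner ℂ (coeffs f) (coeffs g) := rfl

/-- The monomial `z ↦ zⁿ` as an element of `H²`. -/
def monomial (n : ℕ) : HTwo := coeffs.symm (lp.single 2 n 1)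

theorem inner_monomial (n : ℕ) (f : HTwo) : inner ℂ (monomial n) f = coeffs f n := by
  rw [inner_def, monomial, LinearEquiv.apply_symm_apply, lp.inner_single_left]
  simp

theorem monomial_apply (n : ℕ) (z : 𝔻) : monomial n z = (z : ℂ) ^ n := by
  rw [apply_eq_tsum, monomial, LinearEquiv.apply_symm_apply, tsum_eq_single n]
  · simp
  · intro m hm
    simp [lp.single_apply, hm]

theorem eq_zero_of_inner_monomial {f : HTwo} (h : ∀ n, inner ℂ (monomial n) f = 0) : f = 0 := by
  apply coeffs.injective
  ext n
  rw [← inner_monomial, h, map_zero]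
  rfl

theorem hasSum_norm_inner_monomial_sq (f : HTwo) :
    HasSum (fun n => ‖inner ℂ (monomial n) f‖ ^ 2) (‖f‖ ^ 2) := by
  have h := lp.hasSum_norm (p := 2) (by norm_num) (coeffs f)
  simp only [norm_coeffs, ← inner_monomial] at h
  simpa using h

theorem memℓp_geometric (w : 𝔻) : Memℓp (fun n : ℕ => conj (w : ℂ) ^ n) 2 := by
  rw [memℓp_gen_iff (by norm_num)]
  have h : Summable fun n : ℕ => (‖(w : ℂ)‖ ^ 2) ^ n :=
    summable_geometric_of_lt_one (by positivity) w.sq_norm_lt_one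
  refine h.congr fun n => ?_
  simp [← pow_mul, mul_comm]

/-- The reproducing kernel `k_w(z) = 1 / (1 - w̄ z)` of `H²`, given by its Taylor coefficients. -/
def kernel (w : 𝔻) : HTwo := coeffs.symm ⟨fun n => conj (w : ℂ) ^ n, memℓp_geometric w⟩

theorem coeffs_kernel (w : 𝔻) (n : ℕ) : coeffs (kernel w) n = conj (w : ℂ) ^ n := by
  rw [kernel, LinearEquiv.apply_symm_apply]

theorem inner_kernel (w : 𝔻) (f : HTwo) : inner ℂ (kernel w) f = f w := by
  rw [inner_def, lp.inner_eq_tsum, apply_eq_tsum]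
  refine tsum_congr fun n => ?_
  rw [coeffs_kernel]
  simp

theorem norm_conj_mul_lt_one (w z : 𝔻) : ‖conj (w : ℂ) * z‖ < 1 := by
  rw [norm_mul, RCLike.norm_conj]
  exact mul_lt_one_of_nonneg_of_lt_one_left (norm_nonneg _) w.norm_lt_one z.norm_lt_one.le

theorem one_sub_conj_mul_ne_zero (w z : 𝔻) : (1 : ℂ) - conj (w : ℂ) * z ≠ 0 := by
  intro h
  have h1 := norm_conj_mul_lt_one w z
  rw [← sub_eq_zero.mp h] at h1
  simp at h1

theorem kernel_apply (w z : 𝔻) : kernel w z = (1 - conj (w : ℂ) * z)⁻¹ := by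
  rw [apply_eq_tsum, ← tsum_geometric_of_norm_lt_one (norm_conj_mul_lt_one w z)]
  refine tsum_congr fun n => ?_
  rw [coeffs_kernel, mul_pow]

theorem kernel_ne_zero (w : 𝔻) : kernel w ≠ 0 := fun h => by
  have h1 : kernel w w ≠ 0 := by
    rw [kernel_apply]
    exact inv_ne_zero (one_sub_conj_mul_ne_zero w w)
  exact h1 (by rw [h, zero_apply])

end HTwo

/-! ### Holomorphic functions on the disc -/

theorem unitDisc_mem_ball (z : 𝔻) : (z : ℂ) ∈ Metric.ball (0 : ℂ) 1 :=
  mem_ball_zero_iff.2 z.norm_lt_one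

theorem HTwo.holomorphic (f : HTwo) : Holomorphic f.1 := by
  refine ⟨fun z => ∑' n, coeffs f n * z ^ n, ?_, fun z => f.apply_eq_tsum z⟩
  have key : HasFPowerSeriesOnBall (fun z : ℂ => ∑' n, coeffs f n * z ^ n)
      (FormalMultilinearSeries.ofScalars ℂ (fun n => coeffs f n)) 0 1 := by
    refine ⟨?_, one_pos, ?_⟩
    · refine ENNReal.le_of_forall_nnreal_lt fun r hr => ?_
      have hr1 : (r : ℝ) < 1 := by exact_mod_cast hr
      refine FormalMultilinearSeries.le_radius_of_bound _ ‖coeffs f‖ fun n => ?_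
      rw [FormalMultilinearSeries.ofScalars_norm]
      exact (mul_le_of_le_one_right (norm_nonneg _) (pow_le_one₀ r.2 hr1.le)).trans
        (lp.norm_apply_le_norm (by norm_num) (coeffs f) n)
    · intro y hy
      have hy' : ‖y‖ < 1 := by
        rw [← ENNReal.coe_one, Metric.eball_coe] at hy
        simpa using hy
      have hs := (summable_powerSeries (coeffs f) (Complex.UnitDisc.mk y hy')).hasSum
      simpa [FormalMultilinearSeries.ofScalars_apply_eq, smul_eq_mul, mul_comm] using hs
  have h := key.differentiableOn
  rwa [← ENNReal.coe_one, Metric.eball_coe] at h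

namespace Holomorphic

variable {f g : 𝔻 → ℂ}

theorem mul (hf : Holomorphic f) (hg : Holomorphic g) : Holomorphic fun z => f z * g z := by
  obtain ⟨F, hF, hfF⟩ := hf
  obtain ⟨G, hG, hgG⟩ := hg
  exact ⟨fun z => F z * G z, hF.mul hG, fun z => by simp only [hfF, hgG]⟩

theorem sub (hf : Holomorphic f) (hg : Holomorphic g) : Holomorphic fun z => f z - g z := by
  obtain ⟨F, hF, hfF⟩ := hf
  obtain ⟨G, hG, hgG⟩ := hg
  exact ⟨fun z => F z - G z, hF.sub hG, fun z => by simp only [hfF, hgG]⟩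

theorem coe : Holomorphic fun z => (z : ℂ) := ⟨fun z => z, differentiableOn_id, fun _ => rfl⟩

theorem inv (hf : Holomorphic f) (h0 : ∀ z, f z ≠ 0) : Holomorphic fun z => (f z)⁻¹ := by
  obtain ⟨F, hF, hfF⟩ := hf
  refine ⟨fun z => (F z)⁻¹, hF.inv fun z hz => ?_, fun z => by simp only [hfF]⟩
  have h := h0 (Complex.UnitDisc.mk z (mem_ball_zero_iff.1 hz))
  rwa [hfF] at h

theorem comp (hf : Holomorphic f) {σ : 𝔻 → 𝔻} (hσ : Holomorphic fun z => (σ z : ℂ)) :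
    Holomorphic fun z => f (σ z) := by
  obtain ⟨F, hF, hfF⟩ := hf
  obtain ⟨S, hS, hσS⟩ : ∃ S : ℂ → ℂ, DifferentiableOn ℂ S (Metric.ball 0 1) ∧
    ∀ z : 𝔻, (σ z : ℂ) = S z := hσ
  refine ⟨fun z => F (S z), hF.comp hS fun z hz => ?_, fun z => by simp only [hfF, hσS]⟩
  have h := hσS (Complex.UnitDisc.mk z (mem_ball_zero_iff.1 hz))
  rw [Complex.UnitDisc.coe_mk] at h
  rw [← h]
  exact unitDisc_mem_ball _

/-- Identity theorem: the range of an injective holomorphic self-map of the disc is a set of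
uniqueness for holomorphic functions, since it accumulates at each of its points. -/
theorem eq_of_comp_eq {σ : 𝔻 → 𝔻} (hσ : Holomorphic fun z => (σ z : ℂ))
    (hinj : Function.Injective σ) (hf : Holomorphic f) (hg : Holomorphic g)
    (h : ∀ z, f (σ z) = g (σ z)) (z : 𝔻) : f z = g z := by
  obtain ⟨F, hF, hfF⟩ := hf
  obtain ⟨G, hG, hgG⟩ := hg
  obtain ⟨S, hS, hσS⟩ : ∃ S : ℂ → ℂ, DifferentiableOn ℂ S (Metric.ball 0 1) ∧
    ∀ z : 𝔻, (σ z : ℂ) = S z := hσ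
  have hball : Metric.ball (0 : ℂ) 1 ∈ 𝓝 (0 : ℂ) := Metric.ball_mem_nhds _ one_pos
  have hS0 : S 0 = σ 0 := by rw [hσS, Complex.UnitDisc.coe_zero]
  have htend : Tendsto S (𝓝[≠] 0) (𝓝[≠] (σ 0 : ℂ)) := by
    refine tendsto_nhdsWithin_iff.2 ⟨?_, ?_⟩
    · rw [← hS0]
      exact (hS.differentiableAt hball).continuousAt.tendsto.mono_left nhdsWithin_le_nhds
    · filter_upwards [self_mem_nhdsWithin, nhdsWithin_le_nhds hball] with x hx hx1 hx2
      have h1 := hσS (Complex.UnitDisc.mk x (mem_ball_zero_iff.1 hx1))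
      rw [Complex.UnitDisc.coe_mk, Set.mem_singleton_iff.1 hx2] at h1
      have h2 := hinj (Complex.UnitDisc.coe_injective h1)
      apply hx
      rw [Set.mem_singleton_iff, ← Complex.UnitDisc.coe_zero, ← h2, Complex.UnitDisc.coe_mk]
  have hfreq : ∃ᶠ x in 𝓝[≠] (σ 0 : ℂ), F x = G x := by
    refine htend.frequently (Eventually.frequently ?_)
    filter_upwards [nhdsWithin_le_nhds hball] with x hx
    have h1 := hσS (Complex.UnitDisc.mk x (mem_ball_zero_iff.1 hx))
    rw [Complex.UnitDisc.coe_mk] at h1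
    rw [← h1, ← hfF, ← hgG, h]
  have key := (hF.analyticOnNhd Metric.isOpen_ball).eqOn_of_preconnected_of_frequently_eq
    (hG.analyticOnNhd Metric.isOpen_ball) (convex_ball (0 : ℂ) 1).isPreconnected
    (unitDisc_mem_ball (σ 0)) hfreq
  rw [hfF, hgG]
  exact key (unitDisc_mem_ball z)

end Holomorphic

/-! ### Multiplication by bounded holomorphic functions -/

section Circle

open AddCircle MeasureTheory

/-- Parseval's identity for a continuous function that is the uniform sum of a Fourier series with
non-negative frequencies. -/
theorem hasSum_norm_sq_of_hasSum_fourier {c : ℕ → ℂ} {g : C(AddCircle (1 : ℝ), ℂ)}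
    (hg : HasSum (fun n => c n • fourier (n : ℤ)) g) :
    HasSum (fun n => ‖c n‖ ^ 2)
      (‖ContinuousMap.toLp (E := ℂ) 2 haarAddCircle ℂ g‖ ^ 2) := by
  set G := ContinuousMap.toLp (E := ℂ) 2 (haarAddCircle (T := (1 : ℝ))) ℂ g
  have hv : Orthonormal ℂ fun n : ℕ => fourierLp (T := (1 : ℝ)) 2 (n : ℤ) :=
    orthonormal_fourier.comp _ Nat.cast_injective
  have hsum : HasSum (fun n => c n • fourierLp (T := (1 : ℝ)) 2 (n : ℤ)) G := by
    have h := hg.mapL (ContinuousMap.toLp (E := ℂ) 2 (haarAddCircle (T := (1 : ℝ))) ℂ)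
    simpa only [map_smul] using h
  have hcoeff (m : ℕ) : inner ℂ (fourierLp (T := (1 : ℝ)) 2 (m : ℤ)) G = c m := by
    have h := hsum.mapL (innerSL ℂ (fourierLp (T := (1 : ℝ)) 2 (m : ℤ)))
    refine h.unique ((hasSum_ite_eq m (c m)).congr_fun fun n => ?_)
    rw [innerSL_apply_apply, inner_smul_right, orthonormal_iff_ite.1 hv m n]
    by_cases hmn : n = m
    · simp [hmn]
    · simp [hmn, Ne.symm hmn]
  have h := (hsum.mapL (innerSL ℂ G)).mapL Complex.reCLM
  simp only [innerSL_apply_apply] at h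
  convert h using 1
  · funext n
    rw [inner_smul_right, ← inner_conj_symm, hcoeff, Complex.mul_conj, Complex.normSq_eq_norm_sq]
    rfl
  · rw [inner_self_eq_norm_sq_to_K]
    norm_cast

/-- If `∑ bₙ zⁿ` converges on the disc, then its restriction to the circle of radius `r < 1` is a
uniformly convergent Fourier series. -/
theorem exists_hasSum_fourier {b : ℕ → ℂ} {P : 𝔻 → ℂ}
    (hP : ∀ z : 𝔻, HasSum (fun n => b n * (z : ℂ) ^ n) (P z)) {r : ℝ} (hr0 : 0 ≤ r) (hr1 : r < 1) :
    ∃ g : C(AddCircle (1 : ℝ), ℂ),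
      HasSum (fun n => (b n * (r : ℂ) ^ n) • fourier (n : ℤ)) g ∧
      ∀ x, ∃ z : 𝔻, (z : ℂ) = r * fourier 1 x ∧ g x = P z := by
  have hr : ‖(r : ℂ)‖ < 1 := by simpa [abs_of_nonneg hr0] using hr1
  have hs : Summable fun n =>
      ((b n * (r : ℂ) ^ n) • fourier (n : ℤ) : C(AddCircle (1 : ℝ), ℂ)) := by
    refine Summable.of_norm ?_
    simp only [norm_smul, fourier_norm, mul_one]
    exact (hP (Complex.UnitDisc.mk r hr)).summable.norm
  refine ⟨_, hs.hasSum, fun x => ?_⟩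
  have hx : ‖(r : ℂ) * fourier 1 x‖ < 1 := by
    rw [norm_mul, fourier_one, Circle.norm_coe, mul_one]
    exact hr
  refine ⟨Complex.UnitDisc.mk _ hx, Complex.UnitDisc.coe_mk _ _, ?_⟩
  refine (hs.hasSum.mapL (ContinuousMap.evalCLM ℂ x)).unique ?_
  convert hP (Complex.UnitDisc.mk _ hx) using 2 with n
  rw [Complex.UnitDisc.coe_mk, mul_pow, ← mul_assoc]
  simp [fourier_apply, AddCircle.toCircle_nsmul]

/-- If `|Q| ≤ C |P|` on the disc, then the square sum of the Taylor coefficients of `Q` is at most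
`C²` times that of `P`: compare the mean squares on the circles of radius `r` and let `r → 1`. -/
theorem sum_norm_sq_le_of_norm_le {a b : ℕ → ℂ} {P Q : 𝔻 → ℂ} {C N : ℝ}
    (hP : ∀ z : 𝔻, HasSum (fun n => a n * (z : ℂ) ^ n) (P z))
    (hQ : ∀ z : 𝔻, HasSum (fun n => b n * (z : ℂ) ^ n) (Q z))
    (hPQ : ∀ z, ‖Q z‖ ≤ C * ‖P z‖) (hN : HasSum (fun n => ‖a n‖ ^ 2) N) (s : Finset ℕ) :
    ∑ n ∈ s, ‖b n‖ ^ 2 ≤ C ^ 2 * N := by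
  have key : ∀ r : ℝ, 0 ≤ r → r < 1 → ∑ n ∈ s, (‖b n‖ * r ^ n) ^ 2 ≤ C ^ 2 * N := by
    intro r hr0 hr1
    obtain ⟨g, hg, hgP⟩ := exists_hasSum_fourier hP hr0 hr1
    obtain ⟨h, hh, hhQ⟩ := exists_hasSum_fourier hQ hr0 hr1
    have hle : ‖ContinuousMap.toLp (E := ℂ) 2 haarAddCircle ℂ h‖ ≤
        C * ‖ContinuousMap.toLp (E := ℂ) 2 haarAddCircle ℂ g‖ := by
      refine Lp.norm_le_mul_norm_of_ae_le_mul ?_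
      filter_upwards [ContinuousMap.coeFn_toLp (E := ℂ) (p := 2) (𝕜 := ℂ) haarAddCircle h,
        ContinuousMap.coeFn_toLp (E := ℂ) (p := 2) (𝕜 := ℂ) haarAddCircle g] with x hx1 hx2
      obtain ⟨z, hz, hgz⟩ := hgP x
      obtain ⟨w, hw, hhw⟩ := hhQ x
      obtain rfl : z = w := Complex.UnitDisc.coe_injective (hz.trans hw.symm)
      rw [hx1, hx2, hgz, hhw]
      exact hPQ z
    have hg2 := hasSum_norm_sq_of_hasSum_fourier hg
    have hh2 := hasSum_norm_sq_of_hasSum_fourier hh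
    have hnorm (c : ℂ) (n : ℕ) : ‖c * (r : ℂ) ^ n‖ = ‖c‖ * r ^ n := by
      rw [norm_mul, norm_pow, Complex.norm_real, Real.norm_of_nonneg hr0]
    simp only [hnorm] at hg2 hh2
    calc ∑ n ∈ s, (‖b n‖ * r ^ n) ^ 2
        ≤ ‖ContinuousMap.toLp (E := ℂ) 2 haarAddCircle ℂ h‖ ^ 2 :=
          sum_le_hasSum s (fun _ _ => by positivity) hh2
      _ ≤ (C * ‖ContinuousMap.toLp (E := ℂ) 2 haarAddCircle ℂ g‖) ^ 2 := by gcongr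
      _ = C ^ 2 * ‖ContinuousMap.toLp (E := ℂ) 2 haarAddCircle ℂ g‖ ^ 2 := by ring
      _ ≤ C ^ 2 * N := by
          refine mul_le_mul_of_nonneg_left (hasSum_le (fun n => ?_) hg2 hN) (sq_nonneg C)
          gcongr
          exact mul_le_of_le_one_right (norm_nonneg _) (pow_le_one₀ hr0 hr1.le)
  have hcont : Continuous fun r : ℝ => ∑ n ∈ s, (‖b n‖ * r ^ n) ^ 2 := by fun_prop
  have hlim : Tendsto (fun r : ℝ => ∑ n ∈ s, (‖b n‖ * r ^ n) ^ 2) (𝓝[<] 1)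
      (𝓝 (∑ n ∈ s, ‖b n‖ ^ 2)) := by
    have h := (hcont.tendsto 1).mono_left (nhdsWithin_le_nhds (s := Set.Iio 1))
    simpa using h
  refine le_of_tendsto hlim ?_
  filter_upwards [Ioo_mem_nhdsLT (zero_lt_one' ℝ)] with r hr
  exact key r hr.1.le hr.2

end Circle

theorem Holomorphic.exists_hasSum {f : 𝔻 → ℂ} (hf : Holomorphic f) :
    ∃ b : ℕ → ℂ, ∀ z : 𝔻, HasSum (fun n => b n * (z : ℂ) ^ n) (f z) := by
  obtain ⟨F, hF, hfF⟩ := hf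
  refine ⟨fun n => (n.factorial : ℂ)⁻¹ * iteratedDeriv n F 0, fun z => ?_⟩
  have h := Complex.hasSum_taylorSeries_on_ball hF (unitDisc_mem_ball z)
  rw [hfF]
  refine h.congr_fun fun n => ?_
  simp only [sub_zero, smul_eq_mul]
  ring

/-- A product of a function in `H²` and a bounded holomorphic function is in `H²`. -/
theorem HTwo.exists_mul {h : 𝔻 → ℂ} (hh : Holomorphic h) {C : ℝ} (hC : ∀ z, ‖h z‖ ≤ C)
    (f : HTwo) : ∃ g : HTwo, (∀ z, g z = h z * f z) ∧ ‖g‖ ≤ C * ‖f‖ := by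
  have hC0 : 0 ≤ C := (norm_nonneg _).trans (hC 0)
  obtain ⟨b, hb⟩ := (hh.mul f.holomorphic).exists_hasSum
  have hN : HasSum (fun n => ‖coeffs f n‖ ^ 2) (‖f‖ ^ 2) := by
    simpa only [inner_monomial] using hasSum_norm_inner_monomial_sq f
  have key := sum_norm_sq_le_of_norm_le f.hasSum_apply hb
    (fun z => by rw [norm_mul]; gcongr; exact hC z) hN
  have hmem : Memℓp b 2 := memℓp_gen' (C := C ^ 2 * ‖f‖ ^ 2) fun s => by simpa using key s
  refine ⟨coeffs.symm ⟨b, hmem⟩, fun z => ?_, ?_⟩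
  · rw [apply_eq_tsum, LinearEquiv.apply_symm_apply]
    exact (hb z).tsum_eq
  · rw [← norm_coeffs, LinearEquiv.apply_symm_apply]
    refine lp.norm_le_of_forall_sum_le (by norm_num) (by positivity) fun s => ?_
    simpa [mul_pow] using key s

/-- Bounded holomorphic functions act on `H²` by multiplication. -/
theorem MemHInfty.exists_mulOperator {h : 𝔻 → ℂ} (hh : MemHInfty h) :
    ∃ M : HTwo →L[ℂ] HTwo, ∀ f z, M f z = h z * f z := by
  obtain ⟨hol, C, hC⟩ := hh
  choose M hM hMC using HTwo.exists_mul hol hC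
  let L : HTwo →ₗ[ℂ] HTwo :=
    { toFun := M
      map_add' := fun f g => HTwo.ext_apply fun z => by
        simp only [HTwo.add_apply, hM, mul_add]
      map_smul' := fun c f => HTwo.ext_apply fun z => by
        simp only [HTwo.smul_apply, hM, RingHom.id_apply, mul_left_comm] }
  exact ⟨L.mkContinuous C hMC, hM⟩

/-! ### Automorphisms of the disc -/

theorem norm_mobius_lt_one (a z : 𝔻) : ‖((z : ℂ) - a) / (1 - conj (a : ℂ) * z)‖ < 1 := by
  have h0 := HTwo.one_sub_conj_mul_ne_zero a z
  rw [norm_div, div_lt_one (norm_pos_iff.2 h0), ← sq_lt_sq₀ (norm_nonneg _) (norm_nonneg _),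
    ← Complex.normSq_eq_norm_sq, ← Complex.normSq_eq_norm_sq]
  have ha := a.normSq_lt_one
  have hz := z.normSq_lt_one
  -- `|1 - ā z|² - |z - a|² = (1 - |a|²) (1 - |z|²)`
  have h : 0 < (1 - Complex.normSq a) * (1 - Complex.normSq z) :=
    mul_pos (sub_pos.2 ha) (sub_pos.2 hz)
  simp only [Complex.normSq_apply, Complex.sub_re, Complex.sub_im, Complex.mul_re, Complex.mul_im,
    Complex.conj_re, Complex.conj_im, Complex.one_re, Complex.one_im] at h ⊢
  nlinarith

/-- The Blaschke factor `z ↦ (z - a) / (1 - ā z)` as a self-map of the disc. -/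
def mobius (a z : 𝔻) : 𝔻 := Complex.UnitDisc.mk _ (norm_mobius_lt_one a z)

theorem coe_mobius (a z : 𝔻) : (mobius a z : ℂ) = (z - a) / (1 - conj (a : ℂ) * z) := rfl

theorem mobius_neg_mobius (a z : 𝔻) : mobius (-a) (mobius a z) = z := by
  apply Complex.UnitDisc.coe_injective
  have h0 := HTwo.one_sub_conj_mul_ne_zero a z
  have h1 := HTwo.one_sub_conj_mul_ne_zero (-a) (mobius a z)
  rw [coe_mobius, div_eq_iff h1]
  rw [coe_mobius, Complex.UnitDisc.coe_neg, map_neg]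
  linear_combination div_mul_cancel₀ ((z : ℂ) - a) h0

theorem holomorphic_mobius (a : 𝔻) : Holomorphic fun z => (mobius a z : ℂ) := by
  refine ⟨fun z => (z - a) / (1 - conj (a : ℂ) * z), ?_, fun z => coe_mobius a z⟩
  refine DifferentiableOn.div (by fun_prop) (by fun_prop) fun z hz => ?_
  exact HTwo.one_sub_conj_mul_ne_zero a (Complex.UnitDisc.mk z (mem_ball_zero_iff.1 hz))

/-- Schwarz lemma for self-maps of the disc. -/
theorem norm_le_norm_of_fixes_zero {τ : 𝔻 → 𝔻} (hτ : Holomorphic fun z => (τ z : ℂ))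
    (h0 : τ 0 = 0) (z : 𝔻) : ‖(τ z : ℂ)‖ ≤ ‖(z : ℂ)‖ := by
  obtain ⟨F, hF, hτF⟩ : ∃ F : ℂ → ℂ, DifferentiableOn ℂ F (Metric.ball 0 1) ∧
    ∀ z : 𝔻, (τ z : ℂ) = F z := hτ
  rw [hτF]
  refine Complex.norm_le_norm_of_mapsTo_ball (R := 1) hF (fun w hw => ?_) ?_ z.norm_lt_one
  · have h := hτF (Complex.UnitDisc.mk w (mem_ball_zero_iff.1 hw))
    rw [Complex.UnitDisc.coe_mk] at h
    rw [← h]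
    exact Metric.ball_subset_closedBall (unitDisc_mem_ball _)
  · rw [← Complex.UnitDisc.coe_zero, ← hτF, h0]

/-- A holomorphic self-map of the disc preserving the modulus is a rotation. -/
theorem exists_rotation_of_norm_eq {τ : 𝔻 → 𝔻} (hτ : Holomorphic fun z => (τ z : ℂ))
    (h : ∀ z, ‖(τ z : ℂ)‖ = ‖(z : ℂ)‖) : ∃ C : ℂ, ‖C‖ = 1 ∧ ∀ z, (τ z : ℂ) = C * z := by
  obtain ⟨F, hF, hτF⟩ : ∃ F : ℂ → ℂ, DifferentiableOn ℂ F (Metric.ball 0 1) ∧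
    ∀ z : 𝔻, (τ z : ℂ) = F z := hτ
  have hFn : ∀ w ∈ Metric.ball (0 : ℂ) 1, ‖F w‖ = ‖w‖ := fun w hw => by
    have h1 := hτF (Complex.UnitDisc.mk w (mem_ball_zero_iff.1 hw))
    rw [Complex.UnitDisc.coe_mk] at h1
    rw [← h1, h, Complex.UnitDisc.coe_mk]
  have hF0 : F 0 = 0 := by
    have h1 := hFn 0 (Metric.mem_ball_self one_pos)
    rwa [norm_zero, norm_eq_zero] at h1
  have hhalf : (2⁻¹ : ℂ) ∈ Metric.ball (0 : ℂ) 1 := by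
    rw [mem_ball_zero_iff]
    norm_num
  obtain ⟨C, hC, hEq⟩ := Complex.affine_of_mapsTo_ball_of_exists_norm_dslope_eq_div'
    (c := (0 : ℂ)) (R₁ := 1) (R₂ := 1) hF (fun w hw => by
      rw [hF0, mem_closedBall_zero_iff, hFn w hw]
      exact (mem_ball_zero_iff.1 hw).le)
    ⟨2⁻¹, hhalf, by
      rw [dslope_of_ne _ (by norm_num), slope_def_field, hF0, norm_div, sub_zero, sub_zero,
        hFn _ hhalf]
      norm_num⟩
  refine ⟨C, by simpa using hC, fun z => ?_⟩
  rw [hτF, hEq (unitDisc_mem_ball z), hF0]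
  simp [mul_comm]

/-- Automorphisms of the disc are unimodular multiples of Blaschke factors. -/
theorem exists_eq_mul_mobius (e : 𝔻 ≃ 𝔻) (he : Holomorphic fun z => (e z : ℂ))
    (he' : Holomorphic fun z => (e.symm z : ℂ)) :
    ∃ C : ℂ, ‖C‖ = 1 ∧ ∀ z, (e z : ℂ) = C * mobius (e.symm 0) z := by
  set a := e.symm 0 with ha
  have hmob' (z : 𝔻) : mobius a (mobius (-a) z) = z := by
    simpa using mobius_neg_mobius (-a) z
  have hma : mobius a a = 0 := Complex.UnitDisc.coe_injective (by simp [coe_mobius])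
  have hm0 : mobius (-a) 0 = a := by rw [← hma, mobius_neg_mobius]
  have hτ : Holomorphic fun z => (e (mobius (-a) z) : ℂ) := he.comp (holomorphic_mobius (-a))
  have hτ' : Holomorphic fun z => (mobius a (e.symm z) : ℂ) := (holomorphic_mobius a).comp he'
  have hle := norm_le_norm_of_fixes_zero hτ (by rw [hm0, ha, e.apply_symm_apply])
  have hge := norm_le_norm_of_fixes_zero hτ' (by rw [← ha, hma])
  obtain ⟨C, hC, h⟩ := exists_rotation_of_norm_eq hτ fun z => by
    refine le_antisymm (hle z) ?_
    simpa [hmob'] using hge (e (mobius (-a) z))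
  refine ⟨C, hC, fun z => ?_⟩
  rw [← h, mobius_neg_mobius]

/-! ### Composition with an automorphism -/

theorem memHInfty_of_selfMap {σ : 𝔻 → 𝔻} (hσ : Holomorphic fun z => (σ z : ℂ)) :
    MemHInfty fun z => (σ z : ℂ) :=
  ⟨hσ, 1, fun z => (σ z).norm_lt_one.le⟩

theorem memHInfty_kernel (a : 𝔻) : MemHInfty (HTwo.kernel a).1 := by
  refine ⟨(HTwo.kernel a).holomorphic, (1 - ‖(a : ℂ)‖)⁻¹, fun z => ?_⟩
  have ha : 0 < 1 - ‖(a : ℂ)‖ := sub_pos.2 a.norm_lt_one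
  rw [HTwo.kernel_apply, norm_inv]
  gcongr
  calc 1 - ‖(a : ℂ)‖ ≤ 1 - ‖conj (a : ℂ) * z‖ := by
        rw [norm_mul, RCLike.norm_conj]
        gcongr
        exact mul_le_of_le_one_right (norm_nonneg _) z.norm_lt_one.le
    _ ≤ ‖1 - conj (a : ℂ) * z‖ := by simpa using norm_sub_norm_le (1 : ℂ) (conj (a : ℂ) * z)

theorem memHInfty_one_sub_conj_mul (a : 𝔻) : MemHInfty fun z => 1 - conj (a : ℂ) * z := by
  refine ⟨⟨fun z => 1 - conj (a : ℂ) * z, by fun_prop, fun _ => rfl⟩, 2, fun z => ?_⟩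
  refine (norm_sub_le _ _).trans ?_
  have := HTwo.norm_conj_mul_lt_one a z
  rw [norm_one]
  linarith

/-- The shift operator of `H²` is an isometry. -/
theorem HTwo.norm_eq_of_eq_coe_mul {f g : HTwo} (h : ∀ z : 𝔻, g z = z * f z) : ‖g‖ = ‖f‖ := by
  have hg : ∀ n, coeffs g n = if n = 0 then 0 else coeffs f (n - 1) := by
    set b : ℕ → ℂ := fun n => if n = 0 then 0 else coeffs f (n - 1) with hb
    have hN : HasSum (fun n => ‖b n‖ ^ 2) (‖f‖ ^ 2) := by
      rw [← hasSum_nat_add_iff' 1]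
      simpa [hb, inner_monomial] using hasSum_norm_inner_monomial_sq f
    have hmem : Memℓp b 2 := (memℓp_gen_iff (by norm_num)).2 (by simpa using hN.summable)
    have heq : g = coeffs.symm ⟨b, hmem⟩ := ext_apply fun z => by
      rw [h, apply_eq_tsum (coeffs.symm _), LinearEquiv.apply_symm_apply]
      refine (HasSum.tsum_eq ?_).symm
      rw [← hasSum_nat_add_iff' 1]
      simpa [hb, pow_succ', mul_left_comm, mul_assoc] using (f.hasSum_apply z).mul_left (z : ℂ)
    intro n
    rw [heq, LinearEquiv.apply_symm_apply]
  have hf2 := hasSum_norm_inner_monomial_sq f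
  have hg2 := hasSum_norm_inner_monomial_sq g
  rw [← hasSum_nat_add_iff' 1] at hg2
  simp only [inner_monomial, hg] at hf2 hg2
  have h2 := hg2.unique (by simpa using hf2)
  simp at h2
  exact h2

/-- A Blaschke factor acts on `H²` as an isometry: `‖(z - a) h‖ = ‖(1 - ā z) h‖`, because the shift
is isometric. -/
theorem HTwo.norm_eq_of_eq_mobius_mul {C : ℂ} (hC : ‖C‖ = 1) (a : 𝔻) {f g : HTwo}
    (h : ∀ z, g z = C * mobius a z * f z) : ‖g‖ = ‖f‖ := by
  obtain ⟨K, hK⟩ := (memHInfty_kernel a).exists_mulOperator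
  obtain ⟨S, hS⟩ := (memHInfty_of_selfMap (σ := id) Holomorphic.coe).exists_mulOperator
  set p := K f with hp
  have hSp : ‖S p‖ = ‖p‖ := norm_eq_of_eq_coe_mul (hS p)
  have hf : f = p - conj (a : ℂ) • S p := ext_apply fun z => by
    have h0 := one_sub_conj_mul_ne_zero a z
    rw [sub_apply, smul_apply, hS, hp, hK, kernel_apply]
    simp only [id]
    field_simp
  have hg : g = C • (S p - (a : ℂ) • p) := ext_apply fun z => by
    rw [smul_apply, sub_apply, smul_apply, hS, hp, hK, kernel_apply, h, coe_mobius]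
    simp only [id]
    ring
  rw [hg, norm_smul, hC, one_mul, ← sq_eq_sq₀ (norm_nonneg _) (norm_nonneg _), hf,
    @norm_sub_sq ℂ, @norm_sub_sq ℂ, norm_smul, norm_smul, hSp, RCLike.norm_conj,
    inner_smul_right, inner_smul_right, ← inner_conj_symm p (S p), ← map_mul, RCLike.conj_re]

theorem linearMap_inner_of_norm_eq (M : HTwo →L[ℂ] HTwo) (hM : ∀ f, ‖M f‖ = ‖f‖) (f g : HTwo) :
    inner ℂ (M f) (M g) = inner ℂ f g :=
  LinearIsometry.inner_map_map ⟨M.toLinearMap, hM⟩ f g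

/-- Composition with an automorphism `e` of the disc is bounded on `H²`. With `a = e⁻¹(0)`, the
functions `eⁿ k_a` are orthogonal of equal norm, so `f ↦ k_a · (f ∘ e)` is a multiple of an
isometry, and `1 / k_a` is bounded. -/
theorem exists_compOperator (e : 𝔻 ≃ 𝔻) (he : Holomorphic fun z => (e z : ℂ))
    (he' : Holomorphic fun z => (e.symm z : ℂ)) :
    ∃ T : HTwo →L[ℂ] HTwo, ∀ f z, T f z = f (e z) := by
  obtain ⟨C, hC, heC⟩ := exists_eq_mul_mobius e he he'
  set a := e.symm 0 with ha
  obtain ⟨M, hM⟩ := (memHInfty_of_selfMap he).exists_mulOperator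
  have hMiso := linearMap_inner_of_norm_eq M fun f =>
    HTwo.norm_eq_of_eq_mobius_mul hC a fun z => by rw [hM, heC]
  have hsucc (n : ℕ) (f : HTwo) : (M ^ (n + 1)) f = M ((M ^ n) f) := by
    rw [pow_succ']
    rfl
  have hMpow (n : ℕ) (f : HTwo) (z : 𝔻) : (M ^ n) f z = (e z : ℂ) ^ n * f z := by
    induction n with
    | zero => simp
    | succ n ih => rw [hsucc, hM, ih, pow_succ', mul_assoc]
  have hshift (k m n : ℕ) (f g : HTwo) :
      inner ℂ ((M ^ (m + k)) f) ((M ^ (n + k)) g) = inner ℂ ((M ^ m) f) ((M ^ n) g) := by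
    induction k with
    | zero => rfl
    | succ k ih =>
      rw [← add_assoc, ← add_assoc, hsucc, hsucc, hMiso, ih]
  set s : ℝ := ‖HTwo.kernel a‖ with hs
  have hka := HTwo.kernel_ne_zero a
  have hs0 : (s : ℂ) ≠ 0 := by exact_mod_cast norm_ne_zero_iff.2 hka
  -- `⟨k_a, eⁿ k_a⟩ = e(a)ⁿ k_a(a)`, which vanishes for `n > 0`
  have hzero (m k : ℕ) :
      inner ℂ ((M ^ m) (HTwo.kernel a)) ((M ^ (m + k + 1)) (HTwo.kernel a)) = 0 := by
    have h := hshift m 0 (k + 1) (HTwo.kernel a) (HTwo.kernel a)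
    rw [zero_add, show k + 1 + m = m + k + 1 by ring] at h
    rw [h, pow_zero, one_apply_eq_self, HTwo.inner_kernel, hMpow, ha,
      e.apply_symm_apply]
    simp
  have hv : Orthonormal ℂ fun n => (s : ℂ)⁻¹ • (M ^ n) (HTwo.kernel a) := by
    refine ⟨fun n => ?_, fun m n hmn => ?_⟩
    · have h : ‖(M ^ n) (HTwo.kernel a)‖ = s := by
        have h := hshift n 0 0 (HTwo.kernel a) (HTwo.kernel a)
        rw [zero_add, pow_zero, one_apply_eq_self, inner_self_eq_norm_sq_to_K,
          inner_self_eq_norm_sq_to_K] at h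
        rw [hs, ← sq_eq_sq₀ (norm_nonneg _) (norm_nonneg _)]
        exact_mod_cast h
      rw [norm_smul, h, norm_inv, Complex.norm_real, Real.norm_of_nonneg (norm_nonneg _)]
      exact inv_mul_cancel₀ (norm_ne_zero_iff.2 hka)
    · change inner ℂ ((s : ℂ)⁻¹ • (M ^ m) _) ((s : ℂ)⁻¹ • (M ^ n) _) = 0
      rw [inner_smul_left, inner_smul_right]
      rcases lt_or_gt_of_ne hmn with h | h
      · obtain ⟨k, rfl⟩ := Nat.exists_eq_add_of_lt h
        rw [hzero, mul_zero, mul_zero]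
      · obtain ⟨k, rfl⟩ := Nat.exists_eq_add_of_lt h
        rw [← inner_conj_symm, hzero, map_zero, mul_zero, mul_zero]
  set V := hv.orthogonalFamily.linearIsometry with hV
  have hVapply (b : EllTwo) (z : 𝔻) :
      V b z = (s : ℂ)⁻¹ * (HTwo.kernel a z * ∑' n, b n * (e z : ℂ) ^ n) := by
    have h := (hv.orthogonalFamily.hasSum_linearIsometry b).mapL (innerSL ℂ (HTwo.kernel z))
    simp only [innerSL_apply_apply, HTwo.inner_kernel] at h
    rw [hV, ← h.tsum_eq, ← tsum_mul_left, ← tsum_mul_left]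
    refine tsum_congr fun n => ?_
    rw [LinearIsometry.toSpanSingleton_apply, HTwo.smul_apply, HTwo.smul_apply, hMpow]
    ring
  obtain ⟨K, hK⟩ := (memHInfty_one_sub_conj_mul a).exists_mulOperator
  refine ⟨(s : ℂ) • K ∘L V.toContinuousLinearMap ∘L
    (HTwo.coeffsIso.toContinuousLinearEquiv : HTwo →L[ℂ] EllTwo), fun f z => ?_⟩
  have h0 := HTwo.one_sub_conj_mul_ne_zero a z
  change (s : ℂ) * K (V (HTwo.coeffs f)) z = _
  rw [hK, hVapply, HTwo.kernel_apply, ← HTwo.apply_eq_tsum]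
  field_simp

/-! ### Frames and surjective synthesis operators -/

section Frame

variable {H : Type*} [NormedAddCommGroup H] [InnerProductSpace ℂ H] [CompleteSpace H]

/-- The synthesis operator `a ↦ ∑ aₙ xₙ` of a frame is bounded from `ℓ²` onto the space. It is
obtained as the adjoint of the analysis operator `A y = (⟨xₙ, y⟩)ₙ`; it is onto because
`A* A` is bounded below. -/
theorem IsFrame.exists_synthesis {x : ℕ → H} (hx : IsFrame x) :
    ∃ T : EllTwo →L[ℂ] H, Function.Surjective T ∧
      ∀ (y : H) (a : EllTwo), inner ℂ y (T a) = ∑' n, a n * inner ℂ y (x n) := by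
  obtain ⟨C₁, C₂, hC₁, hC₂, h⟩ := hx
  have hmem (y : H) : Memℓp (fun n => inner ℂ (x n) y) 2 := by
    refine (memℓp_gen_iff (by norm_num)).2 ?_
    simpa [norm_inner_symm] using (h y).1
  let L : H →ₗ[ℂ] EllTwo :=
    { toFun := fun y => ⟨fun n => inner ℂ (x n) y, hmem y⟩
      map_add' := fun y z => by ext n; exact inner_add_right _ _ _
      map_smul' := fun c y => by ext n; exact inner_smul_right _ _ _ }
  have hL (y : H) : ‖L y‖ ^ 2 = ∑' n, ‖inner ℂ y (x n)‖ ^ 2 := by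
    have h1 := (lp.hasSum_norm (p := 2) (by norm_num) (L y)).tsum_eq
    simp only [ENNReal.toReal_ofNat, Real.rpow_ofNat] at h1
    rw [← h1]
    exact tsum_congr fun n => by rw [norm_inner_symm]; rfl
  let A : H →L[ℂ] EllTwo := L.mkContinuous √C₂ fun y => by
    rw [← sq_le_sq₀ (norm_nonneg _) (by positivity), mul_pow, Real.sq_sqrt hC₂.le, hL]
    exact (h y).2.2
  have hA (y : H) (n : ℕ) : A y n = inner ℂ (x n) y := rfl
  refine ⟨A.adjoint, ?_, fun y a => ?_⟩
  · have hunit : IsUnit (A.adjoint ∘L A) := by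
      refine ContinuousLinearMap.isUnit_of_forall_le_norm_inner_map _ (c := C₁.toNNReal)
        (Real.toNNReal_pos.2 hC₁) fun y => ?_
      rw [ContinuousLinearMap.comp_apply, ContinuousLinearMap.adjoint_inner_left,
        inner_self_eq_norm_sq_to_K, Real.coe_toNNReal _ hC₁.le, mul_comm]
      have h2 := (h y).2.1
      rw [← hL] at h2
      change C₁ * ‖y‖ ^ 2 ≤ ‖A y‖ ^ 2 at h2
      simpa using h2
    intro y
    obtain ⟨w, hw⟩ := (ContinuousLinearMap.isUnit_iff_bijective.1 hunit).2 y
    exact ⟨A w, hw⟩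
  · rw [ContinuousLinearMap.adjoint_inner_right, lp.inner_eq_tsum]
    refine tsum_congr fun n => ?_
    rw [hA, RCLike.inner_apply, inner_conj_symm]

/-- The images of the monomials under an invertible operator form a frame, since
`∑ |⟨y, W zⁿ⟩|² = ‖W* y‖²`. -/
theorem isFrame_map_monomial {W : HTwo →L[ℂ] HTwo} (hW : IsUnit W) :
    IsFrame fun n => W (HTwo.monomial n) := by
  obtain ⟨V, hV⟩ := hW.exists_right_inv
  have hsum (y : HTwo) : HasSum (fun n => ‖inner ℂ y (W (HTwo.monomial n))‖ ^ 2)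
      (‖W.adjoint y‖ ^ 2) := by
    refine (HTwo.hasSum_norm_inner_monomial_sq (W.adjoint y)).congr_fun fun n => ?_
    rw [norm_inner_symm, ContinuousLinearMap.adjoint_inner_right]
  have hVW (y : HTwo) : V.adjoint (W.adjoint y) = y := by
    have h := congrArg ContinuousLinearMap.adjoint hV
    rw [ContinuousLinearMap.mul_def, ContinuousLinearMap.adjoint_comp] at h
    have h1 := congrArg (fun T : HTwo →L[ℂ] HTwo => T y) h
    refine h1.trans ?_
    rw [← ContinuousLinearMap.star_eq_adjoint, star_one]
    rfl
  have hV0 : 0 < ‖V.adjoint‖ + 1 := by positivity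
  refine ⟨((‖V.adjoint‖ + 1) ^ 2)⁻¹, ‖W.adjoint‖ ^ 2 + 1, by positivity, by positivity, fun y =>
    ⟨(hsum y).summable, ?_, ?_⟩⟩
  · rw [(hsum y).tsum_eq, inv_mul_le_iff₀ (by positivity), ← mul_pow]
    gcongr
    calc ‖y‖ = ‖V.adjoint (W.adjoint y)‖ := by rw [hVW]
      _ ≤ ‖V.adjoint‖ * ‖W.adjoint y‖ := ContinuousLinearMap.le_opNorm _ _
      _ ≤ _ := by gcongr; linarith
  · rw [(hsum y).tsum_eq]
    calc ‖W.adjoint y‖ ^ 2 ≤ (‖W.adjoint‖ * ‖y‖) ^ 2 := by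
          gcongr
          exact ContinuousLinearMap.le_opNorm _ _
      _ = ‖W.adjoint‖ ^ 2 * ‖y‖ ^ 2 := mul_pow _ _ _
      _ ≤ _ := by gcongr; linarith

end Frame

/-! ### Invertible weighted composition operators -/

/-- If `u (f₀ ∘ σ) = 1` and `u (f₁ ∘ σ) = z`, then `z` is determined by `σ z`. -/
theorem injective_of_surjective {u : 𝔻 → ℂ} {σ : 𝔻 → 𝔻} {W : HTwo →L[ℂ] HTwo}
    (hW : ∀ (f : HTwo) z, W f z = u z * f (σ z)) (hsurj : Function.Surjective W) :
    (∀ z, u z ≠ 0) ∧ Function.Injective σ := by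
  obtain ⟨f₀, hf₀⟩ := hsurj (HTwo.monomial 0)
  obtain ⟨f₁, hf₁⟩ := hsurj (HTwo.monomial 1)
  have h0 (z : 𝔻) : u z * f₀ (σ z) = 1 := by rw [← hW, hf₀, HTwo.monomial_apply, pow_zero]
  have h1 (z : 𝔻) : u z * f₁ (σ z) = z := by rw [← hW, hf₁, HTwo.monomial_apply, pow_one]
  refine ⟨fun z => left_ne_zero_of_mul (h0 z ▸ one_ne_zero), fun z w hzw => ?_⟩
  apply Complex.UnitDisc.coe_injective
  have hz := h0 z
  have hz1 := h1 z
  rw [hzw] at hz hz1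
  linear_combination (-z : ℂ) * h0 w - f₀ (σ w) * u w * hz1 + f₁ (σ w) * u w * hz + h1 w

theorem holomorphic_selfMap {φ : 𝔻 → ℂ} (hφ : Holomorphic φ) {σ : 𝔻 → 𝔻}
    (hσ : ∀ z, (σ z : ℂ) = φ z) : Holomorphic fun z => (σ z : ℂ) := by
  simpa only [hσ] using hφ

/-- Testing the frame inequalities on the kernels `k_z` gives `u z ≠ 0` and `|φ z| < 1`; the
synthesis operator of the frame is then the weighted composition operator, which is injective by the
identity theorem. -/
theorem WeightedCompositionInvertible.of_isFrame {u : HTwo} {φ : 𝔻 → ℂ} (hφ : MemHInfty φ)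
    {x : ℕ → HTwo} (hx : ∀ n z, x n z = φ z ^ n * u z) (hframe : IsFrame x) :
    WeightedCompositionInvertible u.1 φ := by
  -- `∑ |⟨k_z, φⁿ u⟩|² = |u z|² ∑ |φ z|²ⁿ` is finite and positive
  have hlt (z : 𝔻) : ‖φ z‖ < 1 := by
    obtain ⟨C₁, C₂, hC₁, -, h⟩ := hframe
    obtain ⟨hs, hl, -⟩ := h (HTwo.kernel z)
    simp only [HTwo.inner_kernel, hx, norm_mul, norm_pow, mul_pow] at hs hl
    have hu : u z ≠ 0 := by
      intro hu
      have : 0 < C₁ * ‖HTwo.kernel z‖ ^ 2 := by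
        have := norm_pos_iff.2 (HTwo.kernel_ne_zero z)
        positivity
      rw [hu] at hl
      simp at hl
      linarith
    have hs2 := (summable_mul_right_iff (pow_ne_zero 2 (norm_ne_zero_iff.2 hu))).1 hs
    have hs3 : Summable fun n : ℕ => (‖φ z‖ ^ 2) ^ n := by
      simpa only [← pow_mul, mul_comm] using hs2
    rw [summable_geometric_iff_norm_lt_one, norm_pow, norm_norm] at hs3
    exact (sq_lt_one_iff₀ (norm_nonneg _)).1 hs3
  obtain ⟨T, hT, hTx⟩ := hframe.exists_synthesis
  set σ : 𝔻 → 𝔻 := fun z => Complex.UnitDisc.mk (φ z) (hlt z)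
  have hσφ (z : 𝔻) : (σ z : ℂ) = φ z := rfl
  set W : HTwo →L[ℂ] HTwo :=
    T ∘L (HTwo.coeffsIso.toContinuousLinearEquiv : HTwo →L[ℂ] EllTwo)
  have hW (f : HTwo) (z : 𝔻) : W f z = u z * f (σ z) := by
    rw [← HTwo.inner_kernel, HTwo.apply_eq_tsum f, ← tsum_mul_left]
    refine (hTx _ _).trans (tsum_congr fun n => ?_)
    rw [HTwo.inner_kernel, hx, hσφ, mul_comm (φ z ^ n), mul_left_comm]
    rfl
  have hsurj : Function.Surjective W := hT.comp HTwo.coeffsIso.surjective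
  obtain ⟨hu, hinj⟩ := injective_of_surjective hW hsurj
  refine ⟨σ, hσφ, W, hW, ContinuousLinearMap.isUnit_iff_bijective.2 ⟨?_, hsurj⟩⟩
  rw [injective_iff_map_eq_zero]
  intro f hf
  refine HTwo.ext_apply (Holomorphic.eq_of_comp_eq (holomorphic_selfMap hφ.1 hσφ) hinj
    f.holomorphic (0 : HTwo).holomorphic fun z => ?_)
  have h := hW f z
  rw [hf, HTwo.zero_apply] at h
  exact (mul_eq_zero.1 h.symm).resolve_left (hu z)

theorem isFrame_of_weightedCompositionInvertible {u : HTwo} {φ : 𝔻 → ℂ} {x : ℕ → HTwo}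
    (hx : ∀ n z, x n z = φ z ^ n * u z) (h : WeightedCompositionInvertible u.1 φ) :
    IsFrame x := by
  obtain ⟨σ, hσ, W, hW, hunit⟩ := h
  have hWx : x = fun n => W (HTwo.monomial n) := funext fun n => HTwo.ext_apply fun z => by
    rw [hx, hW, HTwo.monomial_apply, hσ, mul_comm]
  rw [hWx]
  exact isFrame_map_monomial hunit

/-- A function `h` that multiplies `H²` boundedly into itself is bounded: the adjoint of the
multiplication operator has `k_z` as an eigenvector, with eigenvalue the conjugate of `h z`. -/
theorem norm_le_of_mulOperator {h : 𝔻 → ℂ} {M : HTwo →L[ℂ] HTwo}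
    (hM : ∀ f z, M f z = h z * f z) (z : 𝔻) : ‖h z‖ ≤ ‖M.adjoint‖ := by
  have heig : M.adjoint (HTwo.kernel z) = conj (h z) • HTwo.kernel z := by
    refine ext_inner_right ℂ fun f => ?_
    rw [ContinuousLinearMap.adjoint_inner_left, HTwo.inner_kernel, hM, inner_smul_left,
      HTwo.inner_kernel, Complex.conj_conj]
  have h2 := M.adjoint.le_opNorm (HTwo.kernel z)
  rw [heig, norm_smul, RCLike.norm_conj] at h2
  exact le_of_mul_le_mul_right h2 (norm_pos_iff.2 (HTwo.kernel_ne_zero z))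

/-- The functions `gₙ = W⁻¹ zⁿ` satisfy `u · (gₙ ∘ σ) = zⁿ`. By the identity theorem `gₙ = g₀ ψⁿ`
with `ψ = g₁ / g₀`, and boundedness of `f ↦ (W⁻¹ f) w` makes `(gₙ w)ₙ` square-summable, so that
`|ψ w| < 1`; this `ψ` is the inverse of `σ`. -/
theorem exists_holomorphic_inverse {u : 𝔻 → ℂ} {σ : 𝔻 → 𝔻}
    (hσ : Holomorphic fun z => (σ z : ℂ)) {W : HTwo →L[ℂ] HTwo}
    (hW : ∀ (f : HTwo) z, W f z = u z * f (σ z)) (hunit : IsUnit W) :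
    ∃ e : 𝔻 ≃ 𝔻, (∀ z, e z = σ z) ∧ Holomorphic fun z => (e.symm z : ℂ) := by
  obtain ⟨hu, hinj⟩ :=
    injective_of_surjective hW (ContinuousLinearMap.isUnit_iff_bijective.1 hunit).2
  obtain ⟨V, hV⟩ := hunit.exists_right_inv
  obtain ⟨V', hV'⟩ := hunit.exists_left_inv
  obtain rfl : V' = V := left_inv_eq_right_inv hV' hV
  have hWV (f : HTwo) : W (V' f) = f := congrArg (fun T : HTwo →L[ℂ] HTwo => T f) hV
  have hVW (f : HTwo) : V' (W f) = f := congrArg (fun T : HTwo →L[ℂ] HTwo => T f) hV'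
  set g : ℕ → HTwo := fun n => V' (HTwo.monomial n) with hg
  have hgσ (n : ℕ) (z : 𝔻) : u z * g n (σ z) = (z : ℂ) ^ n := by
    rw [← hW, hg, hWV, HTwo.monomial_apply]
  have hrel {i j k l : ℕ} (h : i + j = k + l) (w : 𝔻) : g i w * g j w = g k w * g l w := by
    refine Holomorphic.eq_of_comp_eq hσ hinj
      ((g i).holomorphic.mul (g j).holomorphic) ((g k).holomorphic.mul (g l).holomorphic)
      (fun z => ?_) w
    refine mul_left_cancel₀ (pow_ne_zero 2 (hu z)) ?_
    have hpow : (z : ℂ) ^ i * (z : ℂ) ^ j = (z : ℂ) ^ k * (z : ℂ) ^ l := by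
      rw [← pow_add, ← pow_add, h]
    rw [← hgσ, ← hgσ, ← hgσ, ← hgσ] at hpow
    linear_combination hpow
  -- `gₙ(w)` is the `n`-th coefficient of the functional `f ↦ (W⁻¹ f) w`
  have hinner (n : ℕ) (w : 𝔻) :
      inner ℂ (V'.adjoint (HTwo.kernel w)) (HTwo.monomial n) = g n w := by
    rw [ContinuousLinearMap.adjoint_inner_left, HTwo.inner_kernel]
  have hg0 (w : 𝔻) : g 0 w ≠ 0 := by
    intro h0
    have hall (n : ℕ) : g n w = 0 := by
      have h := hrel (show n + n = 0 + 2 * n by ring) w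
      rw [h0, zero_mul] at h
      exact mul_self_eq_zero.1 h
    have hzero : V'.adjoint (HTwo.kernel w) = 0 := HTwo.eq_zero_of_inner_monomial fun n => by
      rw [← inner_conj_symm, hinner, hall, map_zero]
    have h1 : inner ℂ (V'.adjoint (HTwo.kernel w)) (W (HTwo.monomial 0)) = 1 := by
      rw [ContinuousLinearMap.adjoint_inner_left, HTwo.inner_kernel, hVW, HTwo.monomial_apply,
        pow_zero]
    rw [hzero, inner_zero_left] at h1
    exact zero_ne_one h1
  have hgpow (n : ℕ) (w : 𝔻) : g n w = g 0 w * (g 1 w * (g 0 w)⁻¹) ^ n := by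
    induction n with
    | zero => simp
    | succ n ih =>
      have h := hrel (show 0 + (n + 1) = 1 + n by ring) w
      rw [pow_succ, ← mul_assoc, ← ih]
      have := hg0 w
      field_simp
      linear_combination h
  have hlt (w : 𝔻) : ‖g 1 w * (g 0 w)⁻¹‖ < 1 := by
    have hs := (HTwo.hasSum_norm_inner_monomial_sq (V'.adjoint (HTwo.kernel w))).summable
    simp only [norm_inner_symm (HTwo.monomial _), hinner] at hs
    have hs2 : Summable fun n : ℕ => ‖g 0 w‖ ^ 2 * (‖g 1 w * (g 0 w)⁻¹‖ ^ 2) ^ n :=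
      hs.congr fun n => by
        rw [hgpow n w, norm_mul, norm_pow]
        ring
    have hs3 := (summable_mul_left_iff (pow_ne_zero 2 (norm_ne_zero_iff.2 (hg0 w)))).1 hs2
    rw [summable_geometric_iff_norm_lt_one, norm_pow, norm_norm] at hs3
    exact (sq_lt_one_iff₀ (norm_nonneg _)).1 hs3
  set ψ : 𝔻 → 𝔻 := fun w => Complex.UnitDisc.mk _ (hlt w)
  have hψhol : Holomorphic fun w => (ψ w : ℂ) :=
    (g 1).holomorphic.mul ((g 0).holomorphic.inv hg0)
  have hψσ (z : 𝔻) : ψ (σ z) = z := by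
    apply Complex.UnitDisc.coe_injective
    change g 1 (σ z) * (g 0 (σ z))⁻¹ = z
    rw [mul_inv_eq_iff_eq_mul₀ (hg0 _)]
    refine mul_left_cancel₀ (hu z) ?_
    have h0 := hgσ 0 z
    have h1 := hgσ 1 z
    rw [pow_zero] at h0
    rw [pow_one] at h1
    linear_combination h1 - (z : ℂ) * h0
  have hσψ (w : 𝔻) : σ (ψ w) = w := by
    apply Complex.UnitDisc.coe_injective
    refine Holomorphic.eq_of_comp_eq hσ hinj (hσ.comp hψhol) Holomorphic.coe (fun z => ?_) w
    rw [hψσ]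
  exact ⟨⟨σ, ψ, hψσ, hσψ⟩, fun _ => rfl, hψhol⟩

theorem automorphism_of_weightedCompositionInvertible {u φ : 𝔻 → ℂ} (hφ : MemHInfty φ)
    (h : WeightedCompositionInvertible u φ) : IsDiscAutomorphism φ ∧ BoundedAboveAndBelow u := by
  obtain ⟨σ, hσφ, W, hW, hunit⟩ := h
  have hσ := holomorphic_selfMap hφ.1 hσφ
  obtain ⟨e, heσ, he'⟩ := exists_holomorphic_inverse hσ hW hunit
  obtain rfl : (e : 𝔻 → 𝔻) = σ := funext heσ
  refine ⟨⟨e, fun z => (hσφ z).symm, hσ, he'⟩, ?_⟩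
  obtain ⟨T, hT⟩ := exists_compOperator e hσ he'
  obtain ⟨T', hT'⟩ := exists_compOperator e.symm he' (by simpa using hσ)
  obtain ⟨hu, -⟩ :=
    injective_of_surjective hW (ContinuousLinearMap.isUnit_iff_bijective.1 hunit).2
  obtain ⟨V, hV⟩ := hunit.exists_right_inv
  have hWV (f : HTwo) : W (V f) = f := congrArg (fun T : HTwo →L[ℂ] HTwo => T f) hV
  -- `W C_e⁻¹` is multiplication by `u`, and `C_e W⁻¹` is multiplication by `1 / u`
  have hM := norm_le_of_mulOperator (h := u) (M := W ∘L T') fun f z => by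
    rw [ContinuousLinearMap.comp_apply, hW, hT', e.symm_apply_apply]
  have hM' := norm_le_of_mulOperator (h := fun z => (u z)⁻¹) (M := T ∘L V) fun f z => by
    rw [ContinuousLinearMap.comp_apply, hT, eq_inv_mul_iff_mul_eq₀ (hu z), ← hW, hWV]
  refine ⟨⟨_, hM⟩, (‖(T ∘L V).adjoint‖ + 1)⁻¹, by positivity, fun z => ?_⟩
  have h1 : ‖u z‖⁻¹ ≤ ‖(T ∘L V).adjoint‖ + 1 := by
    rw [← norm_inv]
    exact (hM' z).trans (by linarith)
  exact inv_le_of_inv_le₀ (norm_pos_iff.2 (hu z)) h1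

theorem weightedCompositionInvertible_of_automorphism {u φ : 𝔻 → ℂ} (huhol : Holomorphic u)
    (hφ : IsDiscAutomorphism φ) (hu : BoundedAboveAndBelow u) :
    WeightedCompositionInvertible u φ := by
  obtain ⟨e, hφe, he, he'⟩ := hφ
  obtain ⟨hC, c, hc, hcu⟩ := hu
  have hu0 (z : 𝔻) : u z ≠ 0 := norm_pos_iff.1 (hc.trans_le (hcu z))
  obtain ⟨T, hT⟩ := exists_compOperator e he he'
  obtain ⟨T', hT'⟩ := exists_compOperator e.symm he' (by simpa using he)
  obtain ⟨M, hM⟩ := MemHInfty.exists_mulOperator ⟨huhol, hC⟩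
  obtain ⟨M', hM'⟩ := MemHInfty.exists_mulOperator (h := fun z => (u z)⁻¹)
    ⟨huhol.inv hu0, c⁻¹, fun z => by rw [norm_inv]; exact inv_anti₀ hc (hcu z)⟩
  refine ⟨e, fun z => (hφe z).symm, M ∘L T, fun f z => ?_, ?_⟩
  · rw [ContinuousLinearMap.comp_apply, hM, hT]
  · refine ⟨⟨M ∘L T, T' ∘L M', ?_, ?_⟩, rfl⟩
    · ext1 f
      refine HTwo.ext_apply fun z => ?_
      change M (T (T' (M' f))) z = f z
      rw [hM, hT, hT', hM', e.symm_apply_apply, mul_inv_cancel_left₀ (hu0 z)]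
    · ext1 f
      refine HTwo.ext_apply fun z => ?_
      change T' (M' (M (T f))) z = f z
      rw [hT', hM', hM, hT, e.apply_symm_apply, inv_mul_cancel_left₀ (hu0 _)]

end Hardy

end

theorem mainTheorem7 (u : Hardy.HTwo) (φ : 𝔻 → ℂ) (hφ : Hardy.MemHInfty φ) :
    ∃ x : ℕ → Hardy.HTwo, (∀ (n : ℕ) (z : 𝔻), x n z = φ z ^ n * u z) ∧
      (Hardy.IsFrame x ↔ Hardy.WeightedCompositionInvertible u φ) ∧
      (Hardy.WeightedCompositionInvertible u φ ↔
        Hardy.IsDiscAutomorphism φ ∧ Hardy.BoundedAboveAndBelow u) := by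
  obtain ⟨M, hM⟩ := hφ.exists_mulOperator
  have hx (n : ℕ) (z : 𝔻) : (M ^ n) u z = φ z ^ n * u z := by
    induction n with
    | zero => simp
    | succ n ih =>
      have hsucc : (M ^ (n + 1)) u = M ((M ^ n) u) := by
        rw [pow_succ']
        rfl
      rw [hsucc, hM, ih, pow_succ', mul_assoc]
  exact ⟨fun n => (M ^ n) u, hx,
    ⟨Hardy.WeightedCompositionInvertible.of_isFrame hφ hx,
      Hardy.isFrame_of_weightedCompositionInvertible hx⟩,
    ⟨Hardy.automorphism_of_weightedCompositionInvertible hφ,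
      fun h => Hardy.weightedCompositionInvertible_of_automorphism u.holomorphic h.1 h.2⟩⟩
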